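/- **Feynman's Theorem.** Let $V$ be a real vector space of dimension $d$ with a fixed basis; let $dx$ be Lebesgue measure in the corresponding coordinates. Let $B$ be a symmetric positive-definite bilinear form on $V$, and let $\det B$ be the determinant of its Gram matrix in that basis. For each $m\ge 0$ let $B_m$ be an $m$-linear form on $V$. Let $g_0,g_1,\dots$ be formal parameters and put $$S(x)=\tfrac12B(x,x)+\sum_{m\ge0}\frac{g_m}{m!}B_m(x,\dots,x),\qquad Z=\hbar^{-d/2}\int_V e^{-S(x)/\hbar}\,dx .$$ The integral is understood as a formal series: $e^{-S(x)/\hbar}$ is expanded as a formal power series in $g_0,g_1,\dots$ and integrated over $V$ coefficient by coefficient. A *graph* is finite, may be empty or disconnected, and may have self-edges and multiple edges. It consists of a set of vertices and a set of half-edges, each half-edge being attached to one vertex, together with a partition of the half-edges into pairs, the edges. The valence of a vertex is the number of half-edges attached to it. An isomorphism is a pair of bijections, one of the vertices and one of the half-edges, compatible with attachment and pairing; $\mathrm{Aut}\,\Gamma$ is the group of isomorphisms from $\Gamma$ to itself (so reversing a self-edge is a nontrivial automorphism). Put $b(\Gamma)=|E(\Gamma)|-|V(\Gamma)|$. For a finitely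 supported sequence $\mathbf n=(n_0,n_1,\dots)$ of nonnegative integers let $G(\mathbf n)$ be the set of isomorphism classes of graphs with exactly $n_i$ vertices of valence $i$ for every $i\ge0$. The amplitude $F_\Gamma$ is the number obtained by putting the tensor $-B_m$ at each $m$-valent vertex and contracting along every edge with the inverse form $B^{-1}$ on $V^\vee$; if $B_m$ is not symmetric, its symmetrization is used (it has the same values $B_m(x,\dots,x)$). Thus $F_\Gamma=1$ for the empty graph. Then every $G(\mathbf n)$ is finite; for every real $\hbar>0$ all coefficients of the expanded integrand are integrable; and every coefficient of $Z$ as a series in the $g_i$ is, as a function of $\hbar>0$, given by a unique Laurent polynomial in $\hbar$, so that $Z$ is a formal series in $g_0,g_1,\dots$ whose coefficients are Laurent polynomials in $\hbar$. This series is $$Z=\frac{(2\pi)^{d/2}}{\sqrt{\det B}}\sum_{\mathbf n}\Bigl(\prod_{i\ge0}g_i^{n_i}\Bigr)\sum_{\Gamma\in G(\mathbf n)}\frac{\hbar^{b(\Gamma)}}{|\mathrm{Aut}\,\Gamma|}\,F_\Gamma ,$$ where the outer sum is over all finitely supported sequences $\mathbf n$ of nonnegative integers. -/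

import Mathlib

open MeasureTheory Finset
open scoped Classical Nat LaurentPolynomial

noncomputable section

/-- A finite graph, possibly disconnected, with self-edges and multiple edges allowed. Every
half-edge `h` is attached to the vertex `root h`; two half-edges `h` and `opp h` form an edge. -/
structure FeynmanGraph : Type 1 where
  Vertex : Type
  HalfEdge : Type
  [fintypeVertex : Fintype Vertex]
  [fintypeHalfEdge : Fintype HalfEdge]
  root : HalfEdge → Vertex
  opp : HalfEdge → HalfEdge
  opp_opp : ∀ h, opp (opp h) = h
  opp_ne : ∀ h, opp h ≠ h

namespace FeynmanGraph

attribute [instance] fintypeVertex fintypeHalfEdge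

/-- The half-edges at a vertex. A self-edge contributes two of them. -/
abbrev Star (Γ : FeynmanGraph) (v : Γ.Vertex) : Type := {h : Γ.HalfEdge // Γ.root h = v}

/-- The valence of a vertex. -/
def valence (Γ : FeynmanGraph) (v : Γ.Vertex) : ℕ := Fintype.card (Γ.Star v)

/-- The edge set `E(Γ)`: the unordered pairs `{h, opp h}`. -/
def edges (Γ : FeynmanGraph) : Finset (Sym2 Γ.HalfEdge) :=
  univ.image fun h => s(h, Γ.opp h)

/-- `b(Γ) = |E(Γ)| - |V(Γ)|`. -/
def b (Γ : FeynmanGraph) : ℤ := (Γ.edges.card : ℤ) - (Fintype.card Γ.Vertex : ℤ)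

/-- `Γ` has `n i` vertices of valence `i` for each `i`. -/
def HasType (Γ : FeynmanGraph) (n : ℕ →₀ ℕ) : Prop :=
  ∀ i, Fintype.card {v : Γ.Vertex // Γ.valence v = i} = n i

/-- Isomorphisms of graphs: compatible bijections of the vertices and of the half-edges. (The
half-edges matter: reversing a self-edge is a nontrivial automorphism.) -/
@[ext]
structure Iso (Γ Δ : FeynmanGraph) where
  vertex : Γ.Vertex ≃ Δ.Vertex
  halfEdge : Γ.HalfEdge ≃ Δ.HalfEdge
  root_comm : ∀ h, Δ.root (halfEdge h) = vertex (Γ.root h)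
  opp_comm : ∀ h, Δ.opp (halfEdge h) = halfEdge (Γ.opp h)

namespace Iso

def refl (Γ : FeynmanGraph) : Iso Γ Γ where
  vertex := Equiv.refl _
  halfEdge := Equiv.refl _
  root_comm _ := rfl
  opp_comm _ := rfl

def symm {Γ Δ : FeynmanGraph} (f : Iso Γ Δ) : Iso Δ Γ where
  vertex := f.vertex.symm
  halfEdge := f.halfEdge.symm
  root_comm h := by
    rw [Equiv.eq_symm_apply, ← f.root_comm, Equiv.apply_symm_apply]
  opp_comm h := by
    rw [Equiv.eq_symm_apply, ← f.opp_comm, Equiv.apply_symm_apply]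

def trans {Γ Δ Θ : FeynmanGraph} (f : Iso Γ Δ) (g : Iso Δ Θ) : Iso Γ Θ where
  vertex := f.vertex.trans g.vertex
  halfEdge := f.halfEdge.trans g.halfEdge
  root_comm h := by simp [f.root_comm, g.root_comm]
  opp_comm h := by simp [f.opp_comm, g.opp_comm]

/-- An isomorphism carries the half-edges at `v` to those at the image of `v`. -/
def star {Γ Δ : FeynmanGraph} (f : Iso Γ Δ) (v : Γ.Vertex) : Γ.Star v ≃ Δ.Star (f.vertex v) :=
  f.halfEdge.subtypeEquiv fun h => by rw [f.root_comm, f.vertex.apply_eq_iff_eq]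

theorem edges_eq {Γ Δ : FeynmanGraph} (f : Iso Γ Δ) :
    Δ.edges = Γ.edges.image (Sym2.map f.halfEdge) := by
  unfold edges
  rw [Finset.image_image]
  ext e
  simp only [Finset.mem_image, Finset.mem_univ, true_and, Function.comp_apply, Sym2.map_mk]
  constructor
  · rintro ⟨h, rfl⟩
    refine ⟨f.halfEdge.symm h, ?_⟩
    simp [← f.opp_comm]
  · rintro ⟨h, rfl⟩
    exact ⟨f.halfEdge h, by simp [f.opp_comm]⟩

theorem b_eq {Γ Δ : FeynmanGraph} (f : Iso Γ Δ) : Γ.b = Δ.b := by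
  unfold b
  rw [f.edges_eq, Finset.card_image_of_injective _ (Sym2.map.injective f.halfEdge.injective),
    Fintype.card_congr f.vertex]

/-- Isomorphic graphs have automorphism groups of the same size. -/
def conj {Γ Δ : FeynmanGraph} (f : Iso Γ Δ) : Iso Γ Γ ≃ Iso Δ Δ where
  toFun a := (f.symm.trans a).trans f
  invFun a := (f.trans a).trans f.symm
  left_inv a := by ext <;> simp [trans, symm]
  right_inv a := by ext <;> simp [trans, symm]

end Iso

/-- `Aut(Γ)`. -/
abbrev Aut (Γ : FeynmanGraph) : Type := Iso Γ Γ

instance (Γ : FeynmanGraph) : Finite Γ.Aut :=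
  Finite.of_injective
    (fun f : Γ.Aut => ((f.vertex, f.halfEdge) : Equiv.Perm Γ.Vertex × Equiv.Perm Γ.HalfEdge))
    fun _ _ h => Iso.ext (congrArg Prod.fst h) (congrArg Prod.snd h)

instance isoSetoid : Setoid FeynmanGraph where
  r Γ Δ := Nonempty (Iso Γ Δ)
  iseqv := ⟨fun Γ => ⟨Iso.refl Γ⟩, fun ⟨f⟩ => ⟨f.symm⟩, fun ⟨f⟩ ⟨g⟩ => ⟨f.trans g⟩⟩

/-- Isomorphism classes of graphs. -/
abbrev IsoClass : Type 1 := Quotient isoSetoid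

/-- `G(𝐧)`: the isomorphism classes of graphs with `n i` vertices of valence `i` for each `i`. -/
def classes (n : ℕ →₀ ℕ) : Set IsoClass := {c | ∃ Γ : FeynmanGraph, Γ.HasType n ∧ ⟦Γ⟧ = c}

end FeynmanGraph

namespace Feynman

variable {V : Type*} [AddCommGroup V] [Module ℝ V]

/-- The value of the `m`-linear form `F` on a family of `m` vectors indexed by an unordered
`m`-element set `X`: the mean over all orderings of `X`, i.e. the value of the symmetrization of
`F`. If `F` is symmetric, all orderings give the same value (`evalOn_eq`). -/
def evalOn {m : ℕ} (F : MultilinearMap ℝ (fun _ : Fin m => V) ℝ) (X : Type) [Fintype X]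
    (x : X → V) : ℝ :=
  (∑ e : Fin m ≃ X, F fun k => x (e k)) / (m ! : ℝ)

theorem evalOn_eq {m : ℕ} (F : MultilinearMap ℝ (fun _ : Fin m => V) ℝ)
    (hF : ∀ (s : Equiv.Perm (Fin m)) (y : Fin m → V), F (fun k => y (s k)) = F y)
    {X : Type} [Fintype X] (x : X → V) (e : Fin m ≃ X) :
    evalOn F X x = F fun k => x (e k) := by
  have h : ∀ e' : Fin m ≃ X, (F fun k => x (e' k)) = F fun k => x (e k) := by
    intro e'
    rw [← hF (e'.trans e.symm) fun k => x (e k)]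
    simp
  unfold evalOn
  simp only [h, Finset.sum_const, Finset.card_univ, nsmul_eq_mul]
  rw [Fintype.card_equiv e, Fintype.card_fin]
  field_simp

theorem evalOn_congr (Bm : ∀ m : ℕ, MultilinearMap ℝ (fun _ : Fin m => V) ℝ) {m m' : ℕ}
    (hm : m = m') {X Y : Type} [Fintype X] [Fintype Y] (f : X ≃ Y) (x : X → V) (y : Y → V)
    (hxy : ∀ a, x a = y (f a)) : evalOn (Bm m) X x = evalOn (Bm m') Y y := by
  subst hm
  unfold evalOn
  congr 1
  refine Fintype.sum_equiv (Equiv.equivCongr (Equiv.refl _) f) _ _ fun e => ?_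
  simp [hxy]

variable {d : ℕ}

/-- The Gram matrix `B(e_i, e_j)` of `B` in the linear coordinates given by the basis `e`. -/
def gram (B : LinearMap.BilinForm ℝ V) (e : Module.Basis (Fin d) ℝ V) :
    Matrix (Fin d) (Fin d) ℝ :=
  Matrix.of fun i j => B (e i) (e j)

/-- The values of the form `B⁻¹` on the dual space on pairs of elements of the dual basis,
as a symmetric function of two indices. -/
def propagator (B : LinearMap.BilinForm ℝ V) (hB : B.IsSymm) (e : Module.Basis (Fin d) ℝ V) :
    {P : Fin d → Fin d → ℝ // ∀ i j, P i j = P j i} :=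
  ⟨fun i j => (gram B e)⁻¹ i j, fun i j => by
    have h : (gram B e).transpose = gram B e := by
      ext i j
      exact hB.eq (e j) (e i)
    have h' : ((gram B e)⁻¹).transpose = (gram B e)⁻¹ := by
      rw [Matrix.transpose_nonsing_inv, h]
    exact (congrFun (congrFun h' i) j).symm⟩

/-- The Feynman amplitude `F_Γ`: the tensor `-B_m` is put at each `m`-valent vertex and all tensors
are contracted along the edges by `B⁻¹`. In coordinates this is the sum, over all assignments `idx`
of indices to the half-edges, of the products of the corresponding coefficients of the vertex
tensors and of the edge tensors. It is the product of the amplitudes of the connected components,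
and it is `1` for the empty graph. -/
def amplitude (B : LinearMap.BilinForm ℝ V) (hB : B.IsSymm)
    (Bm : ∀ m : ℕ, MultilinearMap ℝ (fun _ : Fin m => V) ℝ) (e : Module.Basis (Fin d) ℝ V)
    (Γ : FeynmanGraph) : ℝ :=
  ∑ idx : Γ.HalfEdge → Fin d,
    (∏ v : Γ.Vertex, -evalOn (Bm (Γ.valence v)) (Γ.Star v) fun h => e (idx h)) *
      ∏ p ∈ Γ.edges, Sym2.lift (propagator B hB e) (p.map idx)

theorem amplitude_eq (B : LinearMap.BilinForm ℝ V) (hB : B.IsSymm)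
    (Bm : ∀ m : ℕ, MultilinearMap ℝ (fun _ : Fin m => V) ℝ) (e : Module.Basis (Fin d) ℝ V)
    {Γ Δ : FeynmanGraph} (f : FeynmanGraph.Iso Γ Δ) :
    amplitude B hB Bm e Γ = amplitude B hB Bm e Δ := by
  unfold amplitude
  refine Fintype.sum_equiv (Equiv.arrowCongr f.halfEdge (Equiv.refl _)) _ _ fun idx => ?_
  congr 1
  · refine Fintype.prod_equiv f.vertex _ _ fun v => ?_
    congr 1
    refine evalOn_congr Bm (Fintype.card_congr (f.star v)) (f.star v) _ _ fun a => ?_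
    simp [FeynmanGraph.Iso.star]
  · rw [f.edges_eq, Finset.prod_image
      (fun _ _ _ _ h => Sym2.map.injective f.halfEdge.injective h)]
    refine Finset.prod_congr rfl fun p _ => ?_
    have h : (Equiv.arrowCongr f.halfEdge (Equiv.refl _) idx) ∘ f.halfEdge = idx := by
      ext a
      simp
    rw [Sym2.map_map, h]

/-- `ħ^{b(Γ)} F_Γ / |Aut Γ|`, a Laurent polynomial in the formal variable `ħ`. -/
def graphTerm (B : LinearMap.BilinForm ℝ V) (hB : B.IsSymm)
    (Bm : ∀ m : ℕ, MultilinearMap ℝ (fun _ : Fin m => V) ℝ) (e : Module.Basis (Fin d) ℝ V)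
    (Γ : FeynmanGraph) : ℝ[T;T⁻¹] :=
  LaurentPolynomial.C (amplitude B hB Bm e Γ / (Nat.card Γ.Aut : ℝ)) * LaurentPolynomial.T Γ.b

/-- `ħ^{b(Γ)} F_Γ / |Aut Γ|` as a function of the isomorphism class of `Γ`. -/
def classTerm (B : LinearMap.BilinForm ℝ V) (hB : B.IsSymm)
    (Bm : ∀ m : ℕ, MultilinearMap ℝ (fun _ : Fin m => V) ℝ) (e : Module.Basis (Fin d) ℝ V) :
    FeynmanGraph.IsoClass → ℝ[T;T⁻¹] :=
  Quotient.lift (graphTerm B hB Bm e) fun Γ Δ ⟨f⟩ => by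
    unfold graphTerm
    rw [amplitude_eq B hB Bm e f, f.b_eq, Nat.card_congr f.conj]

/-- The graph sum
`(2π)^{d/2} / √(det B) * ∑_𝐧 (∏ g_i^{n_i}) ∑_{Γ ∈ G(𝐧)} ħ^{b(Γ)} F_Γ / |Aut Γ|`
as a formal power series in `g_0, g_1, …` over the Laurent polynomials in `ħ`: the inner sum is
the coefficient at the monomial `∏ g_i^{n_i}`. -/
def graphSeries (B : LinearMap.BilinForm ℝ V) (hB : B.IsSymm)
    (Bm : ∀ m : ℕ, MultilinearMap ℝ (fun _ : Fin m => V) ℝ) (e : Module.Basis (Fin d) ℝ V) :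
    MvPowerSeries ℕ ℝ[T;T⁻¹] :=
  fun n =>
    LaurentPolynomial.C ((2 * Real.pi) ^ ((d : ℝ) / 2) / Real.sqrt (gram B e).det) *
      ∑ᶠ c ∈ FeynmanGraph.classes n, classTerm B hB Bm e c

/-- `S(x) = B(x,x)/2 + ∑_m g_m B_m(x,…,x)/m!` as a formal power series in `g_0, g_1, …`. -/
def action (B : LinearMap.BilinForm ℝ V)
    (Bm : ∀ m : ℕ, MultilinearMap ℝ (fun _ : Fin m => V) ℝ) (x : V) : MvPowerSeries ℕ ℝ :=
  fun n => MvPowerSeries.coeff n (MvPowerSeries.C (B x x / 2)) +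
    ∑ᶠ m : ℕ, MvPowerSeries.coeff n
      (MvPowerSeries.C ((Bm m fun _ => x) / (m ! : ℝ)) * MvPowerSeries.X m)

/-- The exponential of a formal power series `f` with constant term `a`: `exp(a)` times the
exponential series of `f - a`. -/
def formalExp (f : MvPowerSeries ℕ ℝ) : MvPowerSeries ℕ ℝ :=
  MvPowerSeries.C (Real.exp (MvPowerSeries.constantCoeff f)) *
    (PowerSeries.exp ℝ).subst (f - MvPowerSeries.C (MvPowerSeries.constantCoeff f))

/-- The integrand `exp(-S(x)/ħ)`, expanded as a formal power series in `g_0, g_1, …`, for a real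
value `ħ` and at the point `x` with coordinates `t` in the basis `e`. -/
def integrand (B : LinearMap.BilinForm ℝ V)
    (Bm : ∀ m : ℕ, MultilinearMap ℝ (fun _ : Fin m => V) ℝ) (e : Module.Basis (Fin d) ℝ V)
    (ħ : ℝ) (t : Fin d → ℝ) : MvPowerSeries ℕ ℝ :=
  formalExp (MvPowerSeries.C (-(1 / ħ)) * action B Bm (e.equivFun.symm t))

/-- `ħ^{-d/2} ∫_V exp(-S(x)/ħ) dx` for real `ħ > 0`, as a formal power series in `g_0, g_1, …`
(the integral is taken coefficient by coefficient); `dx` is Lebesgue measure in the linear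
coordinates given by `e`. -/
def partitionFunction (B : LinearMap.BilinForm ℝ V)
    (Bm : ∀ m : ℕ, MultilinearMap ℝ (fun _ : Fin m => V) ℝ) (e : Module.Basis (Fin d) ℝ V)
    (ħ : ℝ) : MvPowerSeries ℕ ℝ :=
  fun n => ħ ^ (-((d : ℝ) / 2)) * ∫ t : Fin d → ℝ, MvPowerSeries.coeff n (integrand B Bm e ħ t)

/-- The formal series `Z` in `ħ` and `g_0, g_1, …` is the expansion of the partition function:
its coefficients are Laurent polynomials in `ħ` that represent, for all `ħ > 0`, the coefficients
of `ħ^{-d/2} ∫_V exp(-S(x)/ħ) dx`. -/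
def IsPartitionSeries (B : LinearMap.BilinForm ℝ V)
    (Bm : ∀ m : ℕ, MultilinearMap ℝ (fun _ : Fin m => V) ℝ) (e : Module.Basis (Fin d) ℝ V)
    (Z : MvPowerSeries ℕ ℝ[T;T⁻¹]) : Prop :=
  ∀ (ħ : ℝ) (hħ : 0 < ħ),
    MvPowerSeries.map (LaurentPolynomial.eval₂ (RingHom.id ℝ) (Units.mk0 ħ hħ.ne')) Z =
      partitionFunction B Bm e ħ

end Feynman

end

noncomputable section

/-! ### Gaussian integrals of polynomials. -/

namespace Feynman

/-! The coefficient of `exp(-S/ħ)` at `∏ g_i^{n_i}` is `exp(-B(x,x)/2ħ)` times `∏ (-B_i(x,…,x)/(ħ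
i!))^{n_i} / n_i!` (`coeff_formalExp_action`). Expanded in coordinates, it is a Gaussian times a
polynomial, with one linear factor for each half-edge of a fixed set of labelled vertices, `n_i` of
them having `i` half-edges. Wick's theorem (`integral_gaussian_mul_prod`) turns the integral into a
sum over the pairings of the half-edges. Each pairing is a graph on the labels, and its term is the
amplitude of that graph.

It remains to count the pairings that give the same graph up to isomorphism. The relabelings of
vertices and half-edges compatible with attachment number `∏ n_i! (i!)^{n_i}`, which is the
denominator already present in the coefficient. By orbit counting
(`card_pairings_iso_mul_card_aut`), `Γ` arises from this number divided by `|Aut Γ|` pairings, hence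
the weight `1/|Aut Γ|`. Each edge carries a covariance `ħ B⁻¹` and each vertex a factor `1/ħ`, which
gives `ħ^{b(Γ)}`. Uniqueness holds because a Laurent polynomial is determined by its values at
positive reals. -/

/-- The moments of the one-dimensional Gaussian weight `exp(-s²/2)`. -/
def gaussianMoment (k : ℕ) : ℝ := ∫ s : ℝ, s ^ k * Real.exp (-(1 / 2) * s ^ 2)

theorem integrable_pow_mul_gaussian (k : ℕ) :
    Integrable fun s : ℝ => s ^ k * Real.exp (-(1 / 2) * s ^ 2) := by
  have h := integrable_rpow_mul_exp_neg_mul_sq (b := 1 / 2) (by norm_num) (s := (k : ℝ))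
    (by have : (0 : ℝ) ≤ k := k.cast_nonneg
        linarith)
  simpa only [Real.rpow_natCast] using h

theorem gaussianMoment_zero : gaussianMoment 0 = Real.sqrt (2 * Real.pi) := by
  unfold gaussianMoment
  simp only [pow_zero, one_mul]
  rw [integral_gaussian]
  congr 1
  ring

/-- Integration by parts, with `s exp(-s²/2)` as the derivative of `-exp(-s²/2)`. For `k = 0` the
factor `k` vanishes, so the truncated `k - 1` is harmless. -/
theorem gaussianMoment_succ (k : ℕ) :
    gaussianMoment (k + 1) = k * gaussianMoment (k - 1) := by
  have h := integral_mul_deriv_eq_deriv_mul_of_integrable (A := ℝ)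
    (u := fun s => s ^ k) (u' := fun s => k * s ^ (k - 1))
    (v := fun s => -Real.exp (-(1 / 2) * s ^ 2))
    (v' := fun s => s * Real.exp (-(1 / 2) * s ^ 2))
    (fun x _ => hasDerivAt_pow k x)
    (fun x _ => by
      have h1 : HasDerivAt (fun s : ℝ => -(1 / 2) * s ^ 2) (-(1 / 2) * (2 * x)) x := by
        simpa using (hasDerivAt_pow 2 x).const_mul (-(1 / 2) : ℝ)
      refine h1.exp.fun_neg.congr_deriv ?_
      ring)
    ((integrable_pow_mul_gaussian (k + 1)).congr (.of_forall fun s => by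
      simp only [Pi.mul_apply]; ring))
    (((integrable_pow_mul_gaussian (k - 1)).const_mul (-k : ℝ)).congr (.of_forall fun s => by
      simp only [Pi.mul_apply]; ring))
    ((integrable_pow_mul_gaussian k).neg.congr (.of_forall fun s => by
      simp only [Pi.mul_apply, Pi.neg_apply]; ring))
  have h1 : gaussianMoment (k + 1) = ∫ s : ℝ, s ^ k * (s * Real.exp (-(1 / 2) * s ^ 2)) := by
    unfold gaussianMoment
    congr 1
    ext s
    ring
  rw [h1, h, gaussianMoment, ← integral_neg, ← integral_const_mul]
  congr 1
  ext s
  ring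

section Multivariate

variable {ι : Type*} [Fintype ι]

/-- The standard Gaussian weight `exp(-|s|²/2)`. -/
def gaussianWeight (s : ι → ℝ) : ℝ := Real.exp (-(1 / 2) * ∑ i, s i ^ 2)

theorem gaussianWeight_eq_prod (s : ι → ℝ) :
    gaussianWeight s = ∏ i, Real.exp (-(1 / 2) * s i ^ 2) := by
  rw [gaussianWeight, Finset.mul_sum, Real.exp_sum]

theorem eval_monomial_mul_gaussianWeight (u : ι →₀ ℕ) (c : ℝ) (s : ι → ℝ) :
    MvPolynomial.eval s (MvPolynomial.monomial u c) * gaussianWeight s =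
      c * ∏ i, (s i ^ u i * Real.exp (-(1 / 2) * s i ^ 2)) := by
  rw [MvPolynomial.eval_monomial, gaussianWeight_eq_prod, Finset.prod_mul_distrib,
    Finsupp.prod_fintype _ _ fun _ => pow_zero _, mul_assoc]

theorem integrable_eval_mul_gaussianWeight (p : MvPolynomial ι ℝ) :
    Integrable fun s : ι → ℝ => MvPolynomial.eval s p * gaussianWeight s := by
  induction p using MvPolynomial.induction_on' with
  | monomial u c =>
    simp only [eval_monomial_mul_gaussianWeight]
    exact (Integrable.fintype_prod fun i => integrable_pow_mul_gaussian (u i)).const_mul c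
  | add p q hp hq => simpa only [map_add, add_mul] using hp.fun_add hq

/-- Integration of polynomials against the standard Gaussian weight. -/
def gaussianIntegral (ι : Type*) [Fintype ι] : MvPolynomial ι ℝ →ₗ[ℝ] ℝ where
  toFun p := ∫ s : ι → ℝ, MvPolynomial.eval s p * gaussianWeight s
  map_add' p q := by
    simp only [map_add, add_mul]
    exact integral_add (integrable_eval_mul_gaussianWeight p) (integrable_eval_mul_gaussianWeight q)
  map_smul' c p := by
    simp only [MvPolynomial.smul_eval, mul_assoc, integral_const_mul, smul_eq_mul, RingHom.id_apply]

theorem gaussianIntegral_apply (p : MvPolynomial ι ℝ) :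
    gaussianIntegral ι p = ∫ s : ι → ℝ, MvPolynomial.eval s p * gaussianWeight s := rfl

theorem gaussianIntegral_monomial (u : ι →₀ ℕ) (c : ℝ) :
    gaussianIntegral ι (MvPolynomial.monomial u c) = c * ∏ i, gaussianMoment (u i) := by
  rw [gaussianIntegral_apply]
  simp only [eval_monomial_mul_gaussianWeight, integral_const_mul]
  rw [integral_fintype_prod_volume_eq_prod fun i s => s ^ u i * Real.exp (-(1 / 2) * s ^ 2)]
  rfl

theorem gaussianIntegral_one :
    gaussianIntegral ι 1 = (2 * Real.pi) ^ ((Fintype.card ι : ℝ) / 2) := by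
  rw [← MvPolynomial.C_1, MvPolynomial.C_apply, gaussianIntegral_monomial]
  simp only [Finsupp.coe_zero, Pi.zero_apply, gaussianMoment_zero, Finset.prod_const, one_mul,
    Finset.card_univ]
  rw [Real.sqrt_eq_rpow, ← Real.rpow_natCast, ← Real.rpow_mul (by positivity)]
  congr 1
  ring

/-- Gaussian integration by parts. -/
theorem gaussianIntegral_X_mul (a : ι) (p : MvPolynomial ι ℝ) :
    gaussianIntegral ι (MvPolynomial.X a * p) = gaussianIntegral ι (MvPolynomial.pderiv a p) := by
  induction p using MvPolynomial.induction_on' with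
  | monomial u c =>
    rw [MvPolynomial.pderiv_monomial, MvPolynomial.X, MvPolynomial.monomial_mul, one_mul,
      gaussianIntegral_monomial, gaussianIntegral_monomial,
      ← Finset.mul_prod_erase univ _ (Finset.mem_univ a),
      ← Finset.mul_prod_erase univ (fun i => gaussianMoment ((u - fun₀ | a => 1) i))
        (Finset.mem_univ a)]
    have h : ∀ i ∈ univ.erase a, gaussianMoment (((fun₀ | a => 1) + u) i) =
        gaussianMoment ((u - fun₀ | a => 1) i) := by
      intro i hi
      have : i ≠ a := (Finset.mem_erase.1 hi).1
      simp [this.symm]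
    rw [Finset.prod_congr rfl h]
    simp only [Finsupp.coe_add, Pi.add_apply, Finsupp.single_eq_same, Finsupp.coe_tsub,
      Pi.sub_apply]
    rw [add_comm 1 (u a), gaussianMoment_succ]
    ring
  | add p q hp hq => rw [mul_add, map_add, hp, hq, map_add, map_add]

/-- The linear form `s ↦ ∑ a_k s_k` as a polynomial. -/
def linearForm (a : ι → ℝ) : MvPolynomial ι ℝ := ∑ k, MvPolynomial.C (a k) * MvPolynomial.X k

theorem eval_linearForm (a s : ι → ℝ) : MvPolynomial.eval s (linearForm a) = ∑ k, a k * s k := by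
  simp [linearForm]

theorem pderiv_linearForm (a : ι → ℝ) (k : ι) :
    MvPolynomial.pderiv k (linearForm a) = MvPolynomial.C (a k) := by
  simp only [linearForm, map_sum, MvPolynomial.pderiv_C_mul, MvPolynomial.pderiv_X]
  rw [Finset.sum_eq_single k] <;> simp +contextual [eq_comm]

theorem pderiv_prod_linearForm {H : Type*} (a : H → ι → ℝ) (S : Finset H) (k : ι) :
    MvPolynomial.pderiv k (∏ h ∈ S, linearForm (a h)) =
      ∑ h ∈ S, MvPolynomial.C (a h k) * ∏ h' ∈ S.erase h, linearForm (a h') := by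
  induction S using Finset.induction_on with
  | empty => simp
  | insert x S hx ih =>
    rw [Finset.prod_insert hx, Derivation.leibniz, ih, pderiv_linearForm, Finset.sum_insert hx,
      Finset.erase_insert hx, smul_eq_mul, smul_eq_mul, Finset.mul_sum, add_comm, mul_comm]
    congr 1
    refine Finset.sum_congr rfl fun h hh => ?_
    have hne : x ≠ h := fun e => hx (e ▸ hh)
    rw [Finset.erase_insert_of_ne hne, Finset.prod_insert fun e => hx (Finset.mem_of_mem_erase e)]
    ring

/-- The recursive step of Wick's theorem: integration by parts lets the linear form differentiate
each other factor in turn, which removes that factor and leaves the inner product of the two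
coefficient vectors. -/
theorem gaussianIntegral_linearForm_mul_prod {H : Type*} (b : ι → ℝ) (a : H → ι → ℝ)
    (S : Finset H) :
    gaussianIntegral ι (linearForm b * ∏ h ∈ S, linearForm (a h)) =
      ∑ h ∈ S, (∑ k, b k * a h k) * gaussianIntegral ι (∏ h' ∈ S.erase h, linearForm (a h')) := by
  rw [linearForm, Finset.sum_mul, map_sum]
  simp only [← MvPolynomial.smul_eq_C_mul, smul_mul_assoc]
  simp only [map_smul, gaussianIntegral_X_mul, pderiv_prod_linearForm, map_sum,
    ← MvPolynomial.smul_eq_C_mul, smul_eq_mul, Finset.mul_sum, Finset.sum_mul, mul_assoc]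
  rw [Finset.sum_comm]

end Multivariate

end Feynman

/-! ### Pairings and Wick's theorem. -/

namespace Feynman

section Pairings

variable {H : Type*} [Fintype H]

/-- The pairings of the elements of `S`, as involutions that move exactly the elements of `S`. -/
def pairings (S : Finset H) : Finset (Equiv.Perm H) :=
  univ.filter fun σ => (∀ h, σ (σ h) = h) ∧ ∀ h, σ h ≠ h ↔ h ∈ S

theorem mem_pairings {S : Finset H} {σ : Equiv.Perm H} :
    σ ∈ pairings S ↔ (∀ h, σ (σ h) = h) ∧ ∀ h, σ h ≠ h ↔ h ∈ S := by
  simp [pairings]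

/-- The pairs of a pairing of `S`. -/
def pairs (S : Finset H) (σ : Equiv.Perm H) : Finset (Sym2 H) := S.image fun h => s(h, σ h)

theorem pairings_empty : pairings (∅ : Finset H) = {1} := by
  ext σ
  rw [mem_pairings, Finset.mem_singleton]
  constructor
  · rintro ⟨-, h⟩
    ext x
    simpa using h x
  · rintro rfl
    simp

/-- Multiplying by the transposition of `x` and its partner makes both points fixed and changes no
other value, so exactly one pair is deleted. -/
theorem swap_mul_mem_pairings_erase {S : Finset H} {σ : Equiv.Perm H} (hσ : σ ∈ pairings S)
    (x : H) : Equiv.swap x (σ x) * σ ∈ pairings ((S.erase x).erase (σ x)) := by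
  rw [mem_pairings] at hσ ⊢
  obtain ⟨h1, h2⟩ := hσ
  have key : ∀ h, (Equiv.swap x (σ x) * σ) h = if h = x ∨ h = σ x then h else σ h := by
    intro h
    rw [Equiv.Perm.mul_apply, Equiv.swap_apply_def]
    have := σ.injective.eq_iff (a := h) (b := x)
    have := h1 x
    have := h1 h
    grind
  simp only [key, Finset.mem_erase, ← h2]
  have := fun h => σ.injective.eq_iff (a := h) (b := x)
  constructor <;> intro h <;> have := h1 x <;> have := h1 h <;> grind

theorem swap_mul_mem_pairings {S : Finset H} {τ : Equiv.Perm H} {x y : H} (hx : x ∈ S)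
    (hy : y ∈ S.erase x) (hτ : τ ∈ pairings ((S.erase x).erase y)) :
    Equiv.swap x y * τ ∈ pairings S ∧ (Equiv.swap x y * τ) x = y := by
  rw [mem_pairings] at hτ ⊢
  obtain ⟨h1, h2⟩ := hτ
  have hτx : τ x = x := by
    by_contra h
    simpa using (h2 x).1 h
  have hτy : τ y = y := by
    by_contra h
    simpa using (h2 y).1 h
  rw [Finset.mem_erase] at hy
  have key : ∀ h, (Equiv.swap x y * τ) h = if h = x then y else if h = y then x else τ h := by
    intro h
    rw [Equiv.Perm.mul_apply, Equiv.swap_apply_def]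
    have := h1 h
    grind
  simp only [key]
  simp only [Finset.mem_erase] at h2
  refine ⟨⟨fun h => ?_, fun h => ?_⟩, by simp⟩
  · have := h1 h
    grind
  · have := h2 h
    grind

theorem pairs_swap_mul {S : Finset H} {τ : Equiv.Perm H} {x y : H} (hx : x ∈ S)
    (hy : y ∈ S.erase x) (hτ : τ ∈ pairings ((S.erase x).erase y)) :
    pairs S (Equiv.swap x y * τ) = insert s(x, y) (pairs ((S.erase x).erase y) τ) ∧
      s(x, y) ∉ pairs ((S.erase x).erase y) τ := by
  have hσ := swap_mul_mem_pairings hx hy hτ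
  rw [mem_pairings] at hτ
  obtain ⟨h1, h2⟩ := hτ
  have hne := (Finset.mem_erase.1 hy).1
  have hS : S = insert x (insert y ((S.erase x).erase y)) := by
    rw [Finset.insert_erase hy, Finset.insert_erase hx]
  have hσy : (Equiv.swap x y * τ) y = x := by
    have := (mem_pairings.1 hσ.1).1 x
    rwa [hσ.2] at this
  constructor
  · conv_lhs => rw [pairs, hS, Finset.image_insert, Finset.image_insert, hσ.2, hσy]
    -- `x` and `y` contribute the same unordered pair, so the two insertions collapse into one.
    rw [Sym2.eq_swap (a := y), Finset.insert_idem]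
    congr 1
    refine Finset.image_congr fun h hh => ?_
    rw [Finset.mem_coe] at hh
    have hh' := hh
    rw [← h2] at hh'
    have h3 : τ h ∈ (S.erase x).erase y := by
      rw [← h2, h1]
      exact hh'.symm
    simp only [Finset.mem_erase] at h3
    simp only [Equiv.Perm.mul_apply]
    rw [Equiv.swap_apply_of_ne_of_ne h3.2.1 h3.1]
  · intro hmem
    obtain ⟨h, hh, he⟩ := Finset.mem_image.1 hmem
    have h3 : τ h ∈ (S.erase x).erase y := by
      rw [← h2, h1]
      exact ((h2 h).2 hh).symm
    simp only [Finset.mem_erase] at h3 hh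
    rw [Sym2.eq_iff] at he
    tauto

/-- Pairings of `S` are classified by the partner `y` of a fixed `x ∈ S` and a pairing of the
rest. -/
theorem sum_pairings {R : Type*} [CommSemiring R] (w : Sym2 H → R) {S : Finset H} {x : H}
    (hx : x ∈ S) :
    ∑ σ ∈ pairings S, ∏ p ∈ pairs S σ, w p =
      ∑ y ∈ S.erase x, w s(x, y) *
        ∑ τ ∈ pairings ((S.erase x).erase y), ∏ p ∈ pairs ((S.erase x).erase y) τ, w p := by
  simp only [Finset.mul_sum]
  rw [Finset.sum_sigma' (S.erase x) (fun y => pairings ((S.erase x).erase y))]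
  -- Deleting and restoring the pair are both multiplication by the same transposition, which is its
  -- own inverse.
  refine Finset.sum_bij' (fun σ _ => (⟨σ x, Equiv.swap x (σ x) * σ⟩ : (_ : H) × Equiv.Perm H))
    (fun q _ => Equiv.swap x q.1 * q.2) ?_ ?_ ?_ ?_ ?_
  · intro σ hσ
    refine Finset.mem_sigma.2 ⟨?_, swap_mul_mem_pairings_erase hσ x⟩
    have h := mem_pairings.1 hσ
    refine Finset.mem_erase.2 ⟨(h.2 x).2 hx, (h.2 _).1 ?_⟩
    rw [h.1]
    exact ((h.2 x).2 hx).symm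
  · intro q hq
    obtain ⟨h1, h2⟩ := Finset.mem_sigma.1 hq
    exact (swap_mul_mem_pairings hx h1 h2).1
  · intro σ hσ
    simp [← mul_assoc]
  · rintro ⟨y, τ⟩ hq
    obtain ⟨h1, h2⟩ := Finset.mem_sigma.1 hq
    have h3 := (swap_mul_mem_pairings hx h1 h2).2
    simp only at h3 ⊢
    rw [h3]
    simp [← mul_assoc]
  · intro σ hσ
    have h := mem_pairings.1 hσ
    have hy : σ x ∈ S.erase x := by
      refine Finset.mem_erase.2 ⟨(h.2 x).2 hx, (h.2 _).1 ?_⟩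
      rw [h.1]
      exact ((h.2 x).2 hx).symm
    have h2 := pairs_swap_mul hx hy (swap_mul_mem_pairings_erase hσ x)
    have h3 : Equiv.swap x (σ x) * (Equiv.swap x (σ x) * σ) = σ := by simp [← mul_assoc]
    rw [h3] at h2
    rw [h2.1, Finset.prod_insert h2.2]

/-- **Wick's theorem** for products of linear forms. -/
theorem gaussianIntegral_prod_linearForm {ι : Type*} [Fintype ι] (a : H → ι → ℝ) (w : Sym2 H → ℝ)
    (hw : ∀ h h', w s(h, h') = ∑ k, a h k * a h' k) (S : Finset H) :
    gaussianIntegral ι (∏ h ∈ S, linearForm (a h)) =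
      (2 * Real.pi) ^ ((Fintype.card ι : ℝ) / 2) *
        ∑ σ ∈ pairings S, ∏ p ∈ pairs S σ, w p := by
  induction S using Finset.strongInduction with
  | H S ih =>
    -- Odd sets need no separate case: the recursion ends at a singleton, where the sum over
    -- partners is empty.
    rcases S.eq_empty_or_nonempty with rfl | ⟨x, hx⟩
    · simp [pairings_empty, pairs, gaussianIntegral_one]
    · rw [sum_pairings w hx, ← Finset.mul_prod_erase S _ hx, gaussianIntegral_linearForm_mul_prod,
        Finset.mul_sum]
      refine Finset.sum_congr rfl fun y hy => ?_
      rw [ih _ ((Finset.erase_ssubset hy).trans (Finset.erase_ssubset hx)), hw]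
      ring

end Pairings

end Feynman

/-! ### Coefficients of the expanded exponential. -/

namespace Feynman

section FormalExp

theorem pow_div_factorial_pred_mul (c : ℝ) {k : ℕ} (hk : k ≠ 0) :
    c * (c ^ (k - 1) / ((k - 1)! : ℝ)) = k * (c ^ k / (k ! : ℝ)) := by
  obtain ⟨j, rfl⟩ := Nat.exists_eq_succ_of_ne_zero hk
  simp only [Nat.succ_eq_add_one, Nat.add_sub_cancel, Nat.factorial_succ, Nat.cast_mul]
  field_simp
  ring

/-- The powers of a linear form `∑ c_m g_m` in infinitely many variables. -/
theorem coeff_pow_of_linear (g : MvPowerSeries ℕ ℝ) (c : ℕ → ℝ)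
    (h1 : ∀ m, MvPowerSeries.coeff (Finsupp.single m 1) g = c m)
    (h0 : ∀ n : ℕ →₀ ℕ, (∀ m, n ≠ Finsupp.single m 1) → MvPowerSeries.coeff n g = 0)
    (k : ℕ) (n : ℕ →₀ ℕ) :
    MvPowerSeries.coeff n (g ^ k) =
      if n.degree = k then k ! * ∏ i ∈ n.support, c i ^ n i / ((n i)! : ℝ) else 0 := by
  induction k generalizing n with
  | zero =>
    rw [pow_zero, MvPowerSeries.coeff_one]
    simp only [Finsupp.degree_eq_zero_iff]
    split_ifs with hn
    · simp [hn]
    · rfl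
  | succ k ih =>
    have hsum : MvPowerSeries.coeff n (g ^ (k + 1)) =
        ∑ m ∈ n.support, c m * MvPowerSeries.coeff (n - Finsupp.single m 1) (g ^ k) := by
      rw [pow_succ', MvPowerSeries.coeff_mul]
      symm
      -- Since `g` has only linear terms, the splittings of `n` that matter take off a single
      -- variable `m` of its support.
      refine Finset.sum_of_injOn (fun m => (Finsupp.single m 1, n - Finsupp.single m 1))
        ?_ ?_ ?_ ?_
      · intro m _ m' _ h
        exact Finsupp.single_left_injective one_ne_zero (congrArg Prod.fst h)
      · intro m hm
        have : Finsupp.single m 1 ≤ n := by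
          rw [Finsupp.single_le_iff]
          exact Nat.one_le_iff_ne_zero.2 (Finsupp.mem_support_iff.1 hm)
        simpa using add_tsub_cancel_of_le this
      · rintro ⟨p, q⟩ hp hnot
        rw [h0 p, zero_mul]
        rintro m rfl
        rw [Finset.HasAntidiagonal.mem_antidiagonal] at hp
        dsimp only at hp
        subst hp
        exact hnot ⟨m, by simp, by simp⟩
      · intro m _
        rw [h1]
    rw [hsum]
    have hdeg : ∀ m ∈ n.support, (n - Finsupp.single m 1).degree + 1 = n.degree := by
      intro m hm
      have : Finsupp.single m 1 ≤ n := by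
        rw [Finsupp.single_le_iff]
        exact Nat.one_le_iff_ne_zero.2 (Finsupp.mem_support_iff.1 hm)
      conv_rhs => rw [← tsub_add_cancel_of_le this, map_add, Finsupp.degree_single]
    have hprod : ∀ m ∈ n.support,
        c m * ∏ i ∈ (n - Finsupp.single m 1).support,
          c i ^ (n - Finsupp.single m 1 : ℕ →₀ ℕ) i /
            (((n - Finsupp.single m 1 : ℕ →₀ ℕ) i)! : ℝ) =
        n m * ∏ i ∈ n.support, c i ^ n i / ((n i)! : ℝ) := by
      intro m hm
      have hs : (n - Finsupp.single m 1).support ⊆ n.support := Finsupp.support_tsub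
      -- When `n m = 1` the support loses `m`; the missing factor is `c m ^ 0 / 0! = 1`.
      rw [Finset.prod_subset hs fun i _ hi => by
          rw [Finsupp.notMem_support_iff.1 hi]; simp,
        ← Finset.mul_prod_erase _ _ hm, ← Finset.mul_prod_erase n.support _ hm, ← mul_assoc,
        ← mul_assoc, ← pow_div_factorial_pred_mul _ (Finsupp.mem_support_iff.1 hm)]
      simp only [Finsupp.coe_tsub, Pi.sub_apply, Finsupp.single_eq_same]
      congr 1
      refine Finset.prod_congr rfl fun i hi => ?_
      have : i ≠ m := (Finset.mem_erase.1 hi).1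
      simp [this.symm]
    split_ifs with hn
    · have : ∀ m ∈ n.support, c m * MvPowerSeries.coeff (n - Finsupp.single m 1) (g ^ k) =
          n m * (k ! * ∏ i ∈ n.support, c i ^ n i / ((n i)! : ℝ)) := by
        intro m hm
        have hd := hdeg m hm
        rw [ih, if_pos (by omega), mul_left_comm, hprod m hm]
        ring
      -- The weights `n m` add up to the degree `k + 1`, which raises `k !` to `(k + 1)!`.
      rw [Finset.sum_congr rfl this, ← Finset.sum_mul, ← Nat.cast_sum]
      rw [← Finsupp.degree_apply, hn, Nat.factorial_succ]
      push_cast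
      ring
    · refine Finset.sum_eq_zero fun m hm => ?_
      have hd := hdeg m hm
      rw [ih, if_neg (by omega), mul_zero]

/-- Only the power of `g` of exponent `n.degree` reaches the monomial `n`, and its factorial cancels
that of the exponential series. -/
theorem coeff_exp_subst_of_linear (g : MvPowerSeries ℕ ℝ) (c : ℕ → ℝ)
    (h1 : ∀ m, MvPowerSeries.coeff (Finsupp.single m 1) g = c m)
    (h0 : ∀ n : ℕ →₀ ℕ, (∀ m, n ≠ Finsupp.single m 1) → MvPowerSeries.coeff n g = 0)
    (n : ℕ →₀ ℕ) :
    MvPowerSeries.coeff n ((PowerSeries.exp ℝ).subst g) =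
      ∏ i ∈ n.support, c i ^ n i / ((n i)! : ℝ) := by
  have hg : MvPowerSeries.constantCoeff g = 0 := by
    rw [← MvPowerSeries.coeff_zero_eq_constantCoeff_apply]
    exact h0 0 fun m => by simp [eq_comm]
  rw [PowerSeries.coeff_subst (PowerSeries.HasSubst.of_constantCoeff_zero hg),
    finsum_eq_single _ n.degree]
  · rw [coeff_pow_of_linear g c h1 h0, if_pos rfl, PowerSeries.coeff_exp, smul_eq_mul,
      ← mul_assoc]
    simp [Nat.factorial_ne_zero]
  · intro k hk
    rw [coeff_pow_of_linear g c h1 h0, if_neg hk.symm, smul_zero]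

variable {V : Type*} [AddCommGroup V] [Module ℝ V]

theorem coeff_action_single (B : LinearMap.BilinForm ℝ V)
    (Bm : ∀ m : ℕ, MultilinearMap ℝ (fun _ : Fin m => V) ℝ) (x : V) (m : ℕ) :
    MvPowerSeries.coeff (Finsupp.single m 1) (action B Bm x) =
      (Bm m fun _ => x) / (m ! : ℝ) := by
  change MvPowerSeries.coeff (Finsupp.single m 1) (MvPowerSeries.C (B x x / 2)) +
    ∑ᶠ m' : ℕ, MvPowerSeries.coeff (Finsupp.single m 1)
      (MvPowerSeries.C ((Bm m' fun _ => x) / (m' ! : ℝ)) * MvPowerSeries.X m') = _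
  simp only [MvPowerSeries.coeff_C_mul, MvPowerSeries.coeff_X, MvPowerSeries.coeff_C]
  rw [finsum_eq_single _ m]
  · simp
  · intro m' hm'
    rw [if_neg, mul_zero]
    intro h
    exact hm' (Finsupp.single_left_injective one_ne_zero h).symm

theorem coeff_action_zero (B : LinearMap.BilinForm ℝ V)
    (Bm : ∀ m : ℕ, MultilinearMap ℝ (fun _ : Fin m => V) ℝ) (x : V) :
    MvPowerSeries.coeff 0 (action B Bm x) = B x x / 2 := by
  change MvPowerSeries.coeff 0 (MvPowerSeries.C (B x x / 2)) +
    ∑ᶠ m' : ℕ, MvPowerSeries.coeff 0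
      (MvPowerSeries.C ((Bm m' fun _ => x) / (m' ! : ℝ)) * MvPowerSeries.X m') = _
  simp

theorem coeff_action_eq_zero (B : LinearMap.BilinForm ℝ V)
    (Bm : ∀ m : ℕ, MultilinearMap ℝ (fun _ : Fin m => V) ℝ) (x : V) {n : ℕ →₀ ℕ} (hn : n ≠ 0)
    (h : ∀ m, n ≠ Finsupp.single m 1) :
    MvPowerSeries.coeff n (action B Bm x) = 0 := by
  change MvPowerSeries.coeff n (MvPowerSeries.C (B x x / 2)) +
    ∑ᶠ m' : ℕ, MvPowerSeries.coeff n
      (MvPowerSeries.C ((Bm m' fun _ => x) / (m' ! : ℝ)) * MvPowerSeries.X m') = _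
  simp only [MvPowerSeries.coeff_C_mul, MvPowerSeries.coeff_X, MvPowerSeries.coeff_C, if_neg hn,
    if_neg (h _), mul_zero, finsum_zero, add_zero]

/-- The coefficients of `exp(a S(x))`. -/
theorem coeff_formalExp_action (B : LinearMap.BilinForm ℝ V)
    (Bm : ∀ m : ℕ, MultilinearMap ℝ (fun _ : Fin m => V) ℝ) (x : V) (a : ℝ) (n : ℕ →₀ ℕ) :
    MvPowerSeries.coeff n (formalExp (MvPowerSeries.C a * action B Bm x)) =
      Real.exp (a * (B x x / 2)) *
        ∏ i ∈ n.support, (a * ((Bm i fun _ => x) / (i ! : ℝ))) ^ n i / ((n i)! : ℝ) := by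
  have hc : MvPowerSeries.constantCoeff (MvPowerSeries.C a * action B Bm x) =
      a * (B x x / 2) := by
    rw [← MvPowerSeries.coeff_zero_eq_constantCoeff_apply, MvPowerSeries.coeff_C_mul,
      coeff_action_zero]
  rw [formalExp, MvPowerSeries.coeff_C_mul, hc]
  congr 1
  refine coeff_exp_subst_of_linear _ (fun i => a * ((Bm i fun _ => x) / (i ! : ℝ))) ?_ ?_ n
  · intro m
    rw [map_sub, MvPowerSeries.coeff_C_mul, coeff_action_single, MvPowerSeries.coeff_C,
      if_neg (by simp), sub_zero]
  · intro n hn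
    rw [map_sub, MvPowerSeries.coeff_C_mul, MvPowerSeries.coeff_C]
    rcases eq_or_ne n 0 with rfl | h0
    · rw [if_pos rfl, coeff_action_zero, sub_self]
    · rw [if_neg h0, coeff_action_eq_zero B Bm x h0 hn, mul_zero, sub_zero]

end FormalExp

/-! ### Uniqueness of the Laurent coefficients. -/

section Laurent

/-- A Laurent polynomial is determined by its values at positive reals. -/
theorem laurent_ext_of_eval₂ {p q : ℝ[T;T⁻¹]}
    (h : ∀ (ħ : ℝ) (hħ : 0 < ħ),
      LaurentPolynomial.eval₂ (RingHom.id ℝ) (Units.mk0 ħ hħ.ne') p =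
        LaurentPolynomial.eval₂ (RingHom.id ℝ) (Units.mk0 ħ hħ.ne') q) : p = q := by
  rw [← sub_eq_zero]
  -- A power of the unit `T` clears the denominators; the resulting polynomial vanishes at all
  -- positive reals, so it is zero.
  obtain ⟨k, f, hf⟩ := LaurentPolynomial.exists_T_pow (p - q)
  have hf0 : f = 0 := by
    refine Polynomial.eq_zero_of_infinite_isRoot f ((Set.Ioi_infinite (0 : ℝ)).mono ?_)
    intro ħ hħ
    have hħ' : 0 < ħ := hħ
    have h1 := congrArg (LaurentPolynomial.eval₂ (RingHom.id ℝ) (Units.mk0 ħ hħ'.ne')) hf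
    rw [LaurentPolynomial.eval₂_toLaurent, map_mul, map_sub, h ħ hħ', sub_self, zero_mul] at h1
    simpa [Polynomial.IsRoot, Polynomial.eval₂_eq_eval_map] using h1
  rw [hf0, map_zero] at hf
  exact (LaurentPolynomial.isUnit_T (R := ℝ) (k : ℤ)).mul_left_eq_zero.1 hf.symm

end Laurent

end Feynman

/-! ### Labelled graphs and orbit counting. -/

namespace FeynmanGraph

open Feynman (pairings mem_pairings)

theorem exists_equiv_of_card_fiber_eq {H H' V V' : Type*} [Fintype H] [Fintype H'] (r : H → V)
    (r' : H' → V') (α : V ≃ V')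
    (hα : ∀ v, Fintype.card {h // r h = v} = Fintype.card {h // r' h = α v}) :
    ∃ β : H ≃ H', ∀ h, r' (β h) = α (r h) := by
  let E : ∀ v, {h // r h = v} ≃ {h // r' h = α v} := fun v => Fintype.equivOfCardEq (hα v)
  let β : H ≃ H' := (Equiv.sigmaFiberEquiv r).symm.trans
    ((Equiv.sigmaCongr α E).trans (Equiv.sigmaFiberEquiv r'))
  exact ⟨β, fun h => (E (r h) ⟨h, rfl⟩).2⟩

/-- The relabelings of the vertices and half-edges of `Γ` by the elements of `V₀` and `H₀`,
compatible with the attachment `r`. -/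
abbrev Labeling {V₀ H₀ : Type} (r : H₀ → V₀) (Γ : FeynmanGraph) : Type :=
  {f : (V₀ ≃ Γ.Vertex) × (H₀ ≃ Γ.HalfEdge) // ∀ h, Γ.root (f.2 h) = f.1 (r h)}

/-- The labelings of `Γ` form a torsor under the compatible relabelings: composing with the inverse
of the given one identifies the two sets. -/
theorem card_labeling {V₀ H₀ : Type} (r : H₀ → V₀) {Γ : FeynmanGraph} (f : Labeling r Γ) :
    Nat.card (Labeling r Γ) =
      Nat.card {f : Equiv.Perm V₀ × Equiv.Perm H₀ // ∀ h, r (f.2 h) = f.1 (r h)} := by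
  refine Nat.card_congr (Equiv.subtypeEquiv
    (Equiv.prodCongr (Equiv.equivCongr (Equiv.refl _) f.1.1.symm)
      (Equiv.equivCongr (Equiv.refl _) f.1.2.symm)) fun g => forall_congr' fun h => ?_)
  rw [← f.1.1.apply_eq_iff_eq (x := r _), ← f.2]
  simp

section Relabelings

variable {V₀ H₀ : Type} [Fintype V₀] [Fintype H₀] (r : H₀ → V₀)

/-- A vertex permutation lifts to the half-edges exactly when it preserves valences, which yields
the first product. Its lifts form a coset of the permutations preserving every fibre of `r`, which
yields the second. -/
theorem card_compatible_perm :
    Nat.card {f : Equiv.Perm V₀ × Equiv.Perm H₀ // ∀ h, r (f.2 h) = f.1 (r h)} =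
      (∏ i ∈ univ.image fun v => Fintype.card {h // r h = v},
        (Fintype.card {v // Fintype.card {h // r h = v} = i})!) *
        ∏ v, (Fintype.card {h // r h = v})! := by
  set val : V₀ → ℕ := fun v => Fintype.card {h // r h = v} with hval
  let A := {α : Equiv.Perm V₀ // val ∘ α = val}
  let e : {f : Equiv.Perm V₀ × Equiv.Perm H₀ // ∀ h, r (f.2 h) = f.1 (r h)} ≃
      Σ α : A, {β : Equiv.Perm H₀ // ∀ h, r (β h) = α.1 (r h)} :=
    { toFun := fun f => ⟨⟨f.1.1, by
        ext v
        exact (Fintype.card_congr (f.1.2.subtypeEquiv fun h => by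
          rw [f.2, f.1.1.apply_eq_iff_eq])).symm⟩, ⟨f.1.2, f.2⟩⟩
      invFun := fun q => ⟨(q.1.1, q.2.1), q.2.2⟩
      left_inv := fun _ => rfl
      right_inv := fun _ => rfl }
  have hfib : ∀ α : A, Nat.card {β : Equiv.Perm H₀ // ∀ h, r (β h) = α.1 (r h)} =
      ∏ v, (Fintype.card {h // r h = v})! := by
    intro α
    obtain ⟨β₀, hβ₀⟩ := exists_equiv_of_card_fiber_eq r r α.1 fun v =>
      (congrFun α.2 v).symm
    have hβ₁ : ∀ h, α.1 (r (β₀.symm h)) = r h := fun h => by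
      rw [← hβ₀, Equiv.apply_symm_apply]
    have e' : {β : Equiv.Perm H₀ // ∀ h, r (β h) = α.1 (r h)} ≃
        {γ : Equiv.Perm H₀ // r ∘ γ = r} :=
      (Equiv.equivCongr (Equiv.refl H₀) β₀.symm).subtypeEquiv fun β => by
        rw [funext_iff]
        refine forall_congr' fun h => ?_
        rw [← hβ₁ (β h), α.1.apply_eq_iff_eq]
        rfl
    rw [Nat.card_congr e', Nat.card_eq_fintype_card]
    convert DomMulAct.stabilizer_card r
  rw [Nat.card_congr e, Nat.card_sigma]
  simp only [hfib, Finset.sum_const, Finset.card_univ, smul_eq_mul]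
  congr 1
  convert DomMulAct.stabilizer_card' val

/-- The graph with half-edges `H₀` attached to the vertices `V₀` by `r` and paired by `σ`. -/
abbrev ofPairing (σ : {σ : Equiv.Perm H₀ // σ ∈ pairings univ}) : FeynmanGraph where
  Vertex := V₀
  HalfEdge := H₀
  root := r
  opp := σ.1
  opp_opp := (mem_pairings.1 σ.2).1
  opp_ne h := ((mem_pairings.1 σ.2).2 h).2 (Finset.mem_univ h)

/-- The pairing of the labels induced by the pairing of the half-edges of `Γ`. -/
def pullPairing (Γ : FeynmanGraph) (β : H₀ ≃ Γ.HalfEdge) :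
    {σ : Equiv.Perm H₀ // σ ∈ pairings univ} :=
  ⟨(β.trans (Function.Involutive.toPerm Γ.opp Γ.opp_opp)).trans β.symm, by
    rw [mem_pairings]
    refine ⟨fun h => by simp [Function.Involutive.toPerm, Γ.opp_opp], fun h => ?_⟩
    simp [Function.Involutive.toPerm, Equiv.symm_apply_eq, Γ.opp_ne]⟩

theorem opp_eq_of_pullPairing (Γ : FeynmanGraph) (β : H₀ ≃ Γ.HalfEdge) (h : H₀) :
    Γ.opp (β h) = β ((pullPairing Γ β).1 h) := by
  simp [pullPairing, Function.Involutive.toPerm]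

theorem sigma_iso_ext {Γ : FeynmanGraph} {σ τ : {σ : Equiv.Perm H₀ // σ ∈ pairings univ}}
    (h : σ = τ) (α : V₀ ≃ Γ.Vertex) (β : H₀ ≃ Γ.HalfEdge) (h₁ h₂ h₃ h₄) :
    (⟨σ, ⟨α, β, h₁, h₂⟩⟩ : Σ σ : {σ : Equiv.Perm H₀ // σ ∈ pairings univ},
      Iso (ofPairing r σ) Γ) = ⟨τ, ⟨α, β, h₃, h₄⟩⟩ := by
  subst h
  rfl

/-- A labeling is the same as a pairing of the labels and an isomorphism. -/
def labelingEquiv (Γ : FeynmanGraph) :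
    Labeling r Γ ≃
      Σ σ : {σ : Equiv.Perm H₀ // σ ∈ pairings univ}, Iso (ofPairing r σ) Γ where
  toFun f := ⟨pullPairing Γ f.1.2, ⟨f.1.1, f.1.2, f.2, opp_eq_of_pullPairing Γ f.1.2⟩⟩
  invFun q := ⟨(q.2.vertex, q.2.halfEdge), q.2.root_comm⟩
  left_inv _ := rfl
  right_inv := by
    rintro ⟨σ, q⟩
    have h : pullPairing Γ q.halfEdge = σ := by
      apply Subtype.ext
      ext h
      apply q.halfEdge.injective
      rw [← opp_eq_of_pullPairing]
      exact q.opp_comm h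
    exact sigma_iso_ext r h q.vertex q.halfEdge _ _ _ _

/-- Composition with a fixed isomorphism. -/
def Iso.transEquiv {Γ Δ : FeynmanGraph} (f : Iso Γ Δ) : Iso Γ Δ ≃ Iso Δ Δ where
  toFun g := f.symm.trans g
  invFun g := f.trans g
  left_inv g := by ext <;> simp [trans, symm]
  right_inv g := by ext <;> simp [trans, symm]

instance (Γ Δ : FeynmanGraph) : Finite (Iso Γ Δ) :=
  Finite.of_injective
    (fun f : Iso Γ Δ =>
      ((f.vertex, f.halfEdge) : (Γ.Vertex ≃ Δ.Vertex) × (Γ.HalfEdge ≃ Δ.HalfEdge)))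
    fun _ _ h => Iso.ext (congrArg Prod.fst h) (congrArg Prod.snd h)

/-- The isomorphisms form a torsor under `Aut Δ` if there are any. -/
theorem card_iso (Γ Δ : FeynmanGraph) :
    Nat.card (Iso Γ Δ) = if (⟦Γ⟧ : IsoClass) = ⟦Δ⟧ then Nat.card Δ.Aut else 0 := by
  split_ifs with h
  · obtain ⟨f⟩ := Quotient.exact h
    exact Nat.card_congr f.transEquiv
  · have : IsEmpty (Iso Γ Δ) := ⟨fun f => h (Quotient.sound ⟨f⟩)⟩
    exact Nat.card_of_isEmpty

/-- Orbit counting: the pairings that yield a graph isomorphic to `Γ`. -/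
theorem card_pairings_iso_mul_card_aut {Γ : FeynmanGraph} (f : Labeling r Γ) :
    #{σ : {σ : Equiv.Perm H₀ // σ ∈ pairings univ} | (⟦ofPairing r σ⟧ : IsoClass) = ⟦Γ⟧} *
        Nat.card Γ.Aut =
      Nat.card {f : Equiv.Perm V₀ × Equiv.Perm H₀ // ∀ h, r (f.2 h) = f.1 (r h)} := by
  -- Labelings of `Γ` are counted twice: as a torsor, and by the pairing that each one induces on
  -- the labels.
  rw [← card_labeling r f, Nat.card_congr (labelingEquiv r Γ), Nat.card_sigma]
  rw [Finset.sum_congr rfl fun σ _ => card_iso (ofPairing r σ) Γ, ← Finset.sum_filter,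
    Finset.sum_const, smul_eq_mul]

end Relabelings

section Types

variable (n : ℕ →₀ ℕ)

/-- Labels for the vertices of a graph with `n i` vertices of valence `i`. -/
abbrev VertexLabel : Type := Σ i : n.support, Fin (n i)

/-- Labels for the half-edges of a graph with `n i` vertices of valence `i`. -/
abbrev HalfEdgeLabel : Type := Σ v : VertexLabel n, Fin v.1

/-- The vertex label to which a half-edge label is attached. -/
abbrev labelRoot : HalfEdgeLabel n → VertexLabel n := Sigma.fst

theorem card_fiber_labelRoot (v : VertexLabel n) [Fintype {h // labelRoot n h = v}] :
    Fintype.card {h // labelRoot n h = v} = v.1 := by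
  rw [Fintype.card_congr (Equiv.sigmaSubtype v), Fintype.card_fin]

theorem card_vertexLabel_valence (i : ℕ) [Fintype {v : VertexLabel n // (v.1 : ℕ) = i}] :
    Fintype.card {v : VertexLabel n // (v.1 : ℕ) = i} = n i := by
  by_cases hi : i ∈ n.support
  · have e : {v : VertexLabel n // (v.1 : ℕ) = i} ≃ Fin (n i) :=
      (Equiv.subtypeEquivRight fun v => by rw [Subtype.ext_iff]).trans
        (Equiv.sigmaSubtype (β := fun i : n.support => Fin (n i)) ⟨i, hi⟩)
    rw [Fintype.card_congr e, Fintype.card_fin]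
  · rw [Finsupp.notMem_support_iff.1 hi, Fintype.card_eq_zero_iff]
    exact ⟨fun v => hi (v.2 ▸ v.1.1.2)⟩

/-- Vertices are matched by valence first, then the half-edges within each star. -/
theorem exists_labeling {Γ : FeynmanGraph} (hΓ : Γ.HasType n) :
    Nonempty (Labeling (labelRoot n) Γ) := by
  obtain ⟨α, hα⟩ := exists_equiv_of_card_fiber_eq (fun v : VertexLabel n => (v.1 : ℕ)) Γ.valence
    (Equiv.refl ℕ) fun i => by
      rw [card_vertexLabel_valence, ← hΓ i]
      convert rfl
      rfl
  obtain ⟨β, hβ⟩ := exists_equiv_of_card_fiber_eq (labelRoot n) Γ.root α fun v => by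
    rw [card_fiber_labelRoot]
    exact (hα v).symm
  exact ⟨⟨(α, β), hβ⟩⟩

theorem valence_ofPairing (σ : {σ : Equiv.Perm (HalfEdgeLabel n) // σ ∈ pairings univ})
    (v : VertexLabel n) : (ofPairing (labelRoot n) σ).valence v = v.1 := by
  rw [valence]
  convert card_fiber_labelRoot n v

theorem hasType_ofPairing (σ : {σ : Equiv.Perm (HalfEdgeLabel n) // σ ∈ pairings univ}) :
    (ofPairing (labelRoot n) σ).HasType n := by
  intro i
  rw [← card_vertexLabel_valence n i]
  simp only [valence_ofPairing]

theorem classes_eq_image :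
    classes n = univ.image fun σ : {σ : Equiv.Perm (HalfEdgeLabel n) // σ ∈ pairings univ} =>
      (⟦ofPairing (labelRoot n) σ⟧ : IsoClass) := by
  ext c
  simp only [Finset.coe_image, Finset.coe_univ, Set.image_univ, Set.mem_range]
  constructor
  · rintro ⟨Γ, hΓ, rfl⟩
    obtain ⟨f⟩ := exists_labeling n hΓ
    exact ⟨_, Quotient.sound ⟨(labelingEquiv (labelRoot n) Γ f).2⟩⟩
  · rintro ⟨σ, rfl⟩
    exact ⟨_, hasType_ofPairing n σ, rfl⟩

theorem finite_classes : (classes n).Finite := by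
  rw [classes_eq_image]
  exact Finset.finite_toSet _

theorem card_compatible_perm_labelRoot :
    Nat.card {f : Equiv.Perm (VertexLabel n) × Equiv.Perm (HalfEdgeLabel n) //
      ∀ h, labelRoot n (f.2 h) = f.1 (labelRoot n h)} =
        ∏ i ∈ n.support, (n i)! * (i !) ^ n i := by
  rw [card_compatible_perm]
  simp only [card_fiber_labelRoot, card_vertexLabel_valence]
  rw [Finset.prod_mul_distrib]
  congr 1
  · refine Finset.prod_subset ?_ ?_
    · intro i hi
      obtain ⟨v, -, rfl⟩ := Finset.mem_image.1 hi
      exact v.1.2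
    · intro i hi hi'
      -- Each `i` in the support has a label because `n i > 0`.
      let v : VertexLabel n := ⟨⟨i, hi⟩, ⟨0, Nat.pos_of_ne_zero (Finsupp.mem_support_iff.1 hi)⟩⟩
      exact absurd (Finset.mem_image.2 ⟨v, Finset.mem_univ _, rfl⟩) hi'
  · rw [Fintype.prod_sigma, ← Finset.prod_coe_sort n.support]
    simp

/-- Sums over pairings of the half-edge labels as sums over isomorphism classes of graphs. -/
theorem sum_pairings_eq_finsum_classes {M : Type*} [AddCommMonoid M] (F : IsoClass → M) :
    ∑ σ : {σ : Equiv.Perm (HalfEdgeLabel n) // σ ∈ pairings univ},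
        Nat.card (ofPairing (labelRoot n) σ).Aut • F ⟦ofPairing (labelRoot n) σ⟧ =
      (∏ i ∈ n.support, (n i)! * (i !) ^ n i) • ∑ᶠ c ∈ classes n, F c := by
  rw [classes_eq_image, finsum_mem_coe_finset, Finset.smul_sum,
    ← Finset.sum_fiberwise_of_maps_to (g := fun σ => (⟦ofPairing (labelRoot n) σ⟧ : IsoClass))
      (t := univ.image fun σ => (⟦ofPairing (labelRoot n) σ⟧ : IsoClass))
      fun σ hσ => Finset.mem_image_of_mem _ hσ]
  refine Finset.sum_congr rfl fun c hc => ?_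
  obtain ⟨τ, -, rfl⟩ := Finset.mem_image.1 hc
  obtain ⟨f⟩ := exists_labeling n (hasType_ofPairing n τ)
  -- The summand depends only on the isomorphism class, so each fibre contributes its cardinality
  -- times one value.
  have h : ∀ σ ∈ univ.filter fun σ => (⟦ofPairing (labelRoot n) σ⟧ : IsoClass) =
      ⟦ofPairing (labelRoot n) τ⟧,
      Nat.card (ofPairing (labelRoot n) σ).Aut • F ⟦ofPairing (labelRoot n) σ⟧ =
        Nat.card (ofPairing (labelRoot n) τ).Aut • F ⟦ofPairing (labelRoot n) τ⟧ := by
    intro σ hσ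
    have h1 := (Finset.mem_filter.1 hσ).2
    obtain ⟨g⟩ := Quotient.exact h1
    rw [h1, Nat.card_congr g.conj]
  rw [Finset.sum_congr rfl h, Finset.sum_const, ← mul_smul, card_pairings_iso_mul_card_aut _ f,
    card_compatible_perm_labelRoot]

end Types

end FeynmanGraph

/-! ### Change of variables to the standard Gaussian. -/

namespace Feynman

section QuadraticForm

open Matrix

variable {d : ℕ}

/-- A linear change of variables that brings the Gaussian weight of covariance `ħ G⁻¹` to the
standard one. -/
theorem exists_gaussian_coordinates {G : Matrix (Fin d) (Fin d) ℝ} (hG : G.PosDef) {ħ : ℝ}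
    (hħ : 0 < ħ) :
    ∃ A : Matrix (Fin d) (Fin d) ℝ, A.det ≠ 0 ∧
      |A.det| = ħ ^ ((d : ℝ) / 2) / Real.sqrt G.det ∧ A * Aᵀ = ħ • G⁻¹ ∧
      ∀ s, (A *ᵥ s) ⬝ᵥ (G *ᵥ (A *ᵥ s)) = ħ * ∑ i, s i ^ 2 := by
  obtain ⟨S, hS⟩ : ∃ S : Matrix (Fin d) (Fin d) ℝ, G = Sᵀ * S := by
    open scoped MatrixOrder in
    obtain ⟨S, hS⟩ := CStarAlgebra.nonneg_iff_eq_star_mul_self.mp hG.posSemidef.nonneg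
    refine ⟨S, ?_⟩
    rw [hS, Matrix.star_eq_conjTranspose, Matrix.conjTranspose_eq_transpose_of_trivial]
  have hdet : G.det = S.det * S.det := by rw [hS, Matrix.det_mul, Matrix.det_transpose]
  have hS0 : S.det ≠ 0 := by
    intro h
    have := hG.det_pos
    rw [hdet, h] at this
    simp at this
  have hSu : IsUnit S.det := isUnit_iff_ne_zero.2 hS0
  have hdetA : (Real.sqrt ħ • S⁻¹).det = Real.sqrt ħ ^ d * S.det⁻¹ := by
    rw [Matrix.det_smul, Fintype.card_fin, Matrix.det_nonsing_inv, Ring.inverse_eq_inv']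
  have hsq : 0 < Real.sqrt ħ := Real.sqrt_pos.2 hħ
  -- With `G = Sᵀ S`, the substitution `t = √ħ S⁻¹ s` gives `tᵀ G t = ħ |s|²`.
  refine ⟨Real.sqrt ħ • S⁻¹, ?_, ?_, ?_, ?_⟩
  · rw [hdetA]
    positivity
  · rw [hdetA, abs_mul, abs_inv, abs_of_pos (by positivity), hdet, Real.sqrt_mul_self_eq_abs,
      div_eq_mul_inv]
    congr 1
    rw [Real.sqrt_eq_rpow, ← Real.rpow_natCast, ← Real.rpow_mul hħ.le]
    congr 1
    ring
  · rw [Matrix.transpose_smul, Matrix.smul_mul, Matrix.mul_smul, smul_smul,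
      Real.mul_self_sqrt hħ.le, hS, Matrix.mul_inv_rev, Matrix.transpose_nonsing_inv]
  · intro s
    rw [hS, ← Matrix.mulVec_mulVec, Matrix.dotProduct_mulVec, Matrix.vecMul_transpose,
      Matrix.mulVec_mulVec, Matrix.mul_smul, Matrix.mul_nonsing_inv _ hSu, Matrix.smul_mulVec,
      Matrix.one_mulVec, smul_dotProduct, dotProduct_smul, smul_smul, Real.mul_self_sqrt hħ.le,
      smul_eq_mul, dotProduct]
    simp only [sq]

theorem measurableEmbedding_mulVec {A : Matrix (Fin d) (Fin d) ℝ} (hA : A.det ≠ 0) :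
    MeasurableEmbedding (Matrix.toLin' A) := by
  refine (LinearMap.continuous_of_finiteDimensional _).measurableEmbedding ?_
  exact Matrix.mulVec_injective_of_isUnit
    ((Matrix.isUnit_iff_isUnit_det A).2 (isUnit_iff_ne_zero.2 hA))

theorem integrable_of_integrable_comp_mulVec {A : Matrix (Fin d) (Fin d) ℝ} (hA : A.det ≠ 0)
    {f : (Fin d → ℝ) → ℝ} (hf : Integrable fun s => f (A *ᵥ s)) : Integrable f := by
  have h : Integrable f (Measure.map (Matrix.toLin' A) volume) :=
    (measurableEmbedding_mulVec hA).integrable_map_iff.2 hf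
  rw [Real.map_matrix_volume_pi_eq_smul_volume_pi hA] at h
  refine (integrable_smul_measure ?_ ENNReal.ofReal_ne_top).1 h
  simpa using hA

theorem integral_eq_abs_det_mul_integral_comp_mulVec {A : Matrix (Fin d) (Fin d) ℝ}
    (hA : A.det ≠ 0) (f : (Fin d → ℝ) → ℝ) :
    ∫ t, f t = |A.det| * ∫ s, f (A *ᵥ s) := by
  have h : ∫ t, f t ∂(Measure.map (Matrix.toLin' A) volume) = ∫ s, f (A *ᵥ s) :=
    (measurableEmbedding_mulVec hA).integral_map f
  rw [← h, Real.map_matrix_volume_pi_eq_smul_volume_pi hA, integral_smul_measure,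
    ENNReal.toReal_ofReal (abs_nonneg _), abs_inv, smul_eq_mul,
    mul_inv_cancel_left₀ (abs_ne_zero.2 hA)]

variable {H : Type*} [Fintype H]

theorem gaussian_prod_comp_mulVec {G A : Matrix (Fin d) (Fin d) ℝ} {ħ : ℝ} (hħ : 0 < ħ)
    (hq : ∀ s, (A *ᵥ s) ⬝ᵥ (G *ᵥ (A *ᵥ s)) = ħ * ∑ i, s i ^ 2) (idx : H → Fin d)
    (s : Fin d → ℝ) :
    Real.exp (-(1 / ħ) * ((A *ᵥ s) ⬝ᵥ (G *ᵥ (A *ᵥ s)) / 2)) * ∏ h, (A *ᵥ s) (idx h) =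
      MvPolynomial.eval s (∏ h, linearForm (A (idx h))) * gaussianWeight s := by
  rw [hq, map_prod, gaussianWeight, mul_comm]
  simp only [eval_linearForm]
  congr 2
  field_simp

theorem integrable_gaussian_mul_prod {G : Matrix (Fin d) (Fin d) ℝ} (hG : G.PosDef) {ħ : ℝ}
    (hħ : 0 < ħ) (idx : H → Fin d) :
    Integrable fun t : Fin d → ℝ =>
      Real.exp (-(1 / ħ) * (t ⬝ᵥ (G *ᵥ t) / 2)) * ∏ h, t (idx h) := by
  obtain ⟨A, hA, -, -, hq⟩ := exists_gaussian_coordinates hG hħ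
  refine integrable_of_integrable_comp_mulVec hA ?_
  simp only [gaussian_prod_comp_mulVec hħ hq]
  exact integrable_eval_mul_gaussianWeight _

/-- **Wick's theorem** for products of coordinates and the covariance `ħ G⁻¹`. -/
theorem integral_gaussian_mul_prod {G : Matrix (Fin d) (Fin d) ℝ} (hG : G.PosDef) {ħ : ℝ}
    (hħ : 0 < ħ) (idx : H → Fin d) (w : Sym2 H → ℝ)
    (hw : ∀ h h', w s(h, h') = G⁻¹ (idx h) (idx h')) :
    ∫ t : Fin d → ℝ, Real.exp (-(1 / ħ) * (t ⬝ᵥ (G *ᵥ t) / 2)) * ∏ h, t (idx h) =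
      ħ ^ ((d : ℝ) / 2) * ((2 * Real.pi) ^ ((d : ℝ) / 2) / Real.sqrt G.det) *
        ∑ σ ∈ pairings (univ : Finset H), ∏ p ∈ pairs univ σ, (ħ * w p) := by
  obtain ⟨A, hA, hdet, hcov, hq⟩ := exists_gaussian_coordinates hG hħ
  rw [integral_eq_abs_det_mul_integral_comp_mulVec hA]
  simp only [gaussian_prod_comp_mulVec hħ hq]
  rw [← gaussianIntegral_apply, gaussianIntegral_prod_linearForm (fun h => A (idx h))
    (fun p => ħ * w p), hdet, Fintype.card_fin]
  · ring
  · intro h h'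
    have := congrFun (congrFun hcov (idx h)) (idx h')
    rw [Matrix.mul_apply, Matrix.smul_apply, smul_eq_mul, ← hw] at this
    exact this.symm

end QuadraticForm

/-! ### Vertex tensors in coordinates. -/

section Expansion

variable {V : Type*} [AddCommGroup V] [Module ℝ V] {d : ℕ}

/-- On equal arguments symmetrization changes nothing, so the integrand of a possibly nonsymmetric
`B_m` can be written with the symmetrized tensor used in amplitudes. -/
theorem evalOn_const {m : ℕ} (F : MultilinearMap ℝ (fun _ : Fin m => V) ℝ) (X : Type) [Fintype X]
    (hX : Fintype.card X = m) (x : V) : (evalOn F X fun _ => x) = F fun _ => x := by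
  unfold evalOn
  rw [Finset.sum_const, Finset.card_univ,
    Fintype.card_equiv (Fintype.equivFinOfCardEq hX).symm, Fintype.card_fin, nsmul_eq_mul]
  field_simp

theorem evalOn_sum_smul {m : ℕ} (F : MultilinearMap ℝ (fun _ : Fin m => V) ℝ) (X : Type)
    [Fintype X] (e : Fin d → V) (t : Fin d → ℝ) :
    (evalOn F X fun _ => ∑ j, t j • e j) =
      ∑ κ : X → Fin d, (evalOn F X fun a => e (κ a)) * ∏ a, t (κ a) := by
  unfold evalOn
  simp only [div_mul_eq_mul_div, ← Finset.sum_div, Finset.sum_mul]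
  rw [Finset.sum_comm]
  congr 1
  refine Finset.sum_congr rfl fun E _ => ?_
  rw [MultilinearMap.map_sum]
  refine Fintype.sum_equiv (Equiv.arrowCongr E (Equiv.refl _)) _ _ fun κ => ?_
  rw [MultilinearMap.map_smul_univ, smul_eq_mul, mul_comm]
  simp only [Equiv.arrowCongr_apply, Equiv.coe_refl, Function.comp_apply, id_eq,
    Equiv.symm_apply_apply]
  congr 1
  exact Fintype.prod_equiv E _ _ fun k => by simp

variable {V₀ H₀ : Type} [Fintype V₀] [Fintype H₀]

/-- The product of the vertex tensors in coordinates, for half-edges attached by `r`. -/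
def vertexCoeff (Bm : ∀ m : ℕ, MultilinearMap ℝ (fun _ : Fin m => V) ℝ) (e : Fin d → V)
    (r : H₀ → V₀) (idx : H₀ → Fin d) : ℝ :=
  ∏ v : V₀, -evalOn (Bm (Fintype.card {h // r h = v})) {h // r h = v} fun h => e (idx h)

theorem prod_neg_eq_sum_vertexCoeff (Bm : ∀ m : ℕ, MultilinearMap ℝ (fun _ : Fin m => V) ℝ)
    (e : Fin d → V) (r : H₀ → V₀) (t : Fin d → ℝ) :
    ∏ v : V₀, -(Bm (Fintype.card {h // r h = v}) fun _ => ∑ j, t j • e j) =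
      ∑ idx : H₀ → Fin d, vertexCoeff Bm e r idx * ∏ h, t (idx h) := by
  have h1 : ∀ v : V₀, -(Bm (Fintype.card {h // r h = v}) fun _ => ∑ j, t j • e j) =
      ∑ κ : {h // r h = v} → Fin d,
        (-evalOn (Bm (Fintype.card {h // r h = v})) {h // r h = v} fun a => e (κ a)) *
          ∏ a, t (κ a) := by
    intro v
    rw [← evalOn_const _ {h // r h = v} rfl, evalOn_sum_smul, ← Finset.sum_neg_distrib]
    simp only [neg_mul]
    convert rfl
  simp only [h1]
  rw [Fintype.prod_sum]
  -- The stars partition the half-edges, so independent index choices at the vertices amount to one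
  -- global assignment.
  let E : (∀ v, {h // r h = v} → Fin d) ≃ (H₀ → Fin d) :=
    (Equiv.piCurry fun v (_ : {h // r h = v}) => Fin d).symm.trans
      (Equiv.arrowCongr (Equiv.sigmaFiberEquiv r) (Equiv.refl _))
  have hE : ∀ κ v (a : {h // r h = v}), E κ a.1 = κ v a := by
    rintro κ v ⟨h, rfl⟩
    rfl
  refine Fintype.sum_equiv E _ _ fun κ => ?_
  rw [Finset.prod_mul_distrib, vertexCoeff]
  simp only [hE]
  congr 1
  rw [← Fintype.prod_sigma' fun v a => t (κ v a)]
  exact Fintype.prod_equiv (Equiv.sigmaFiberEquiv r) _ _ fun q =>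
    congrArg t (hE κ q.1 q.2).symm

end Expansion

/-! ### Comparison of the integral with the graph sum. -/

section Main

open Matrix FeynmanGraph

variable {V : Type*} [AddCommGroup V] [Module ℝ V] {d : ℕ}

theorem gram_quadratic (B : LinearMap.BilinForm ℝ V) (e : Module.Basis (Fin d) ℝ V)
    (t : Fin d → ℝ) :
    B (e.equivFun.symm t) (e.equivFun.symm t) = t ⬝ᵥ (gram B e *ᵥ t) := by
  simp only [Module.Basis.equivFun_symm_apply, map_sum, LinearMap.sum_apply, map_smul,
    LinearMap.smul_apply, smul_eq_mul, dotProduct, mulVec, gram, Matrix.of_apply, Finset.mul_sum]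
  rw [Finset.sum_comm]
  refine Finset.sum_congr rfl fun i _ => Finset.sum_congr rfl fun j _ => ?_
  ring

theorem posDef_gram (B : LinearMap.BilinForm ℝ V) (hB : B.IsSymm)
    (hpos : ∀ x : V, x ≠ 0 → 0 < B x x) (e : Module.Basis (Fin d) ℝ V) : (gram B e).PosDef := by
  refine Matrix.PosDef.of_dotProduct_mulVec_pos ?_ fun t ht => ?_
  · ext i j
    exact hB.eq (e j) (e i)
  · rw [star_trivial, ← gram_quadratic]
    exact hpos _ (e.equivFun.symm.map_ne_zero_iff.2 ht)

variable (B : LinearMap.BilinForm ℝ V)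
  (Bm : ∀ m : ℕ, MultilinearMap ℝ (fun _ : Fin m => V) ℝ) (e : Module.Basis (Fin d) ℝ V)
  (n : ℕ →₀ ℕ)

theorem prod_coupling_eq (a : ℝ) (f : ℕ → ℝ) :
    ∏ i ∈ n.support, (-a * (f i / (i ! : ℝ))) ^ n i / ((n i)! : ℝ) =
      ((∏ i ∈ n.support, (n i)! * (i !) ^ n i : ℕ) : ℝ)⁻¹ * a ^ Fintype.card (VertexLabel n) *
        ∏ v : VertexLabel n, -f v.1 := by
  rw [Fintype.prod_sigma, Fintype.card_sigma, ← Finset.prod_pow_eq_pow_sum]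
  simp only [Finset.prod_const, Finset.card_univ, Fintype.card_fin]
  rw [Finset.prod_coe_sort n.support fun i => a ^ n i,
    Finset.prod_coe_sort n.support fun i => (-f i) ^ n i, Nat.cast_prod, ← Finset.prod_inv_distrib,
    ← Finset.prod_mul_distrib, ← Finset.prod_mul_distrib]
  refine Finset.prod_congr rfl fun i _ => ?_
  push_cast
  rw [neg_mul, neg_pow, mul_pow, div_pow, neg_pow (f i)]
  field_simp

theorem coeff_integrand (ħ : ℝ) (t : Fin d → ℝ) :
    MvPowerSeries.coeff n (integrand B Bm e ħ t) =
      ((∏ i ∈ n.support, (n i)! * (i !) ^ n i : ℕ) : ℝ)⁻¹ *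
        (1 / ħ) ^ Fintype.card (VertexLabel n) *
        ∑ idx : HalfEdgeLabel n → Fin d, vertexCoeff Bm e (labelRoot n) idx *
          (Real.exp (-(1 / ħ) * (t ⬝ᵥ (gram B e *ᵥ t) / 2)) * ∏ h, t (idx h)) := by
  rw [integrand, coeff_formalExp_action, gram_quadratic,
    prod_coupling_eq n (1 / ħ) fun i => Bm i fun _ => e.equivFun.symm t]
  have h : ∏ v : VertexLabel n, -(Bm v.1 fun _ => ∑ j, t j • e j) =
      ∑ idx : HalfEdgeLabel n → Fin d, vertexCoeff Bm e (labelRoot n) idx * ∏ h, t (idx h) := by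
    convert prod_neg_eq_sum_vertexCoeff Bm e (labelRoot n) t using 1
    · exact Finset.prod_congr rfl fun v _ =>
        congrArg (fun i => -(Bm i fun _ => ∑ j, t j • e j)) (by rw [card_fiber_labelRoot])
    · congr!
  rw [Module.Basis.equivFun_symm_apply, h, Finset.mul_sum, Finset.mul_sum, Finset.mul_sum]
  refine Finset.sum_congr rfl fun idx _ => ?_
  ring

theorem integrable_coeff_integrand (hB : B.IsSymm) (hpos : ∀ x : V, x ≠ 0 → 0 < B x x) {ħ : ℝ}
    (hħ : 0 < ħ) :
    Integrable fun t : Fin d → ℝ => MvPowerSeries.coeff n (integrand B Bm e ħ t) := by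
  simp only [coeff_integrand]
  exact (integrable_finsetSum _ fun idx _ =>
    (integrable_gaussian_mul_prod (posDef_gram B hB hpos e) hħ idx).const_mul _).const_mul _

/-- The edges of `ofPairing r σ` unfold to `pairs univ σ.1` and its stars to the fibres of `r`, so a
Wick term summed against the vertex tensors is an amplitude by definition. -/
theorem amplitude_ofPairing (hB : B.IsSymm) {V₀ H₀ : Type} [Fintype V₀] [Fintype H₀] (r : H₀ → V₀)
    (σ : {σ : Equiv.Perm H₀ // σ ∈ pairings univ}) :
    amplitude B hB Bm e (ofPairing r σ) =
      ∑ idx : H₀ → Fin d, vertexCoeff Bm e r idx *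
        ∏ p ∈ pairs univ σ.1, Sym2.lift (propagator B hB e) (p.map idx) :=
  rfl

theorem b_ofPairing {V₀ H₀ : Type} [Fintype V₀] [Fintype H₀] (r : H₀ → V₀)
    (σ : {σ : Equiv.Perm H₀ // σ ∈ pairings univ}) :
    (ofPairing r σ).b = (#(pairs univ σ.1) : ℤ) - (Fintype.card V₀ : ℤ) :=
  rfl

theorem coeff_partitionFunction (hB : B.IsSymm) (hpos : ∀ x : V, x ≠ 0 → 0 < B x x) {ħ : ℝ}
    (hħ : 0 < ħ) :
    MvPowerSeries.coeff n (partitionFunction B Bm e ħ) =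
      (2 * Real.pi) ^ ((d : ℝ) / 2) / Real.sqrt (gram B e).det *
        (((∏ i ∈ n.support, (n i)! * (i !) ^ n i : ℕ) : ℝ)⁻¹ *
          ∑ σ : {σ : Equiv.Perm (HalfEdgeLabel n) // σ ∈ pairings univ},
            amplitude B hB Bm e (ofPairing (labelRoot n) σ) *
              ħ ^ (ofPairing (labelRoot n) σ).b) := by
  have hG := posDef_gram B hB hpos e
  change ħ ^ (-((d : ℝ) / 2)) *
    ∫ t : Fin d → ℝ, MvPowerSeries.coeff n (integrand B Bm e ħ t) = _
  simp only [coeff_integrand]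
  rw [integral_const_mul, integral_finsetSum _ fun idx _ =>
    (integrable_gaussian_mul_prod hG hħ idx).const_mul _]
  have hint : ∀ idx : HalfEdgeLabel n → Fin d,
      ∫ t : Fin d → ℝ, vertexCoeff Bm e (labelRoot n) idx *
          (Real.exp (-(1 / ħ) * (t ⬝ᵥ (gram B e *ᵥ t) / 2)) * ∏ h, t (idx h)) =
        ħ ^ ((d : ℝ) / 2) * ((2 * Real.pi) ^ ((d : ℝ) / 2) / Real.sqrt (gram B e).det) *
          ∑ σ : {σ : Equiv.Perm (HalfEdgeLabel n) // σ ∈ pairings univ},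
            vertexCoeff Bm e (labelRoot n) idx *
              ((∏ p ∈ pairs univ σ.1, Sym2.lift (propagator B hB e) (p.map idx)) *
                ħ ^ #(pairs univ σ.1)) := by
    intro idx
    rw [integral_const_mul, integral_gaussian_mul_prod hG hħ idx
      (fun p => Sym2.lift (propagator B hB e) (p.map idx)) fun h h' => rfl,
      ← Finset.sum_coe_sort (pairings univ), ← Finset.mul_sum]
    simp only [Finset.prod_mul_distrib, Finset.prod_const]
    simp only [mul_comm (ħ ^ _) (∏ p ∈ _, _)]
    ring
  simp only [hint]
  -- With the pairing outermost, the inner sum over indices becomes an amplitude.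
  rw [← Finset.mul_sum, Finset.sum_comm]
  have hσ : ∀ σ : {σ : Equiv.Perm (HalfEdgeLabel n) // σ ∈ pairings univ},
      amplitude B hB Bm e (ofPairing (labelRoot n) σ) * ħ ^ (ofPairing (labelRoot n) σ).b =
        (1 / ħ) ^ Fintype.card (VertexLabel n) *
        ∑ idx : HalfEdgeLabel n → Fin d, vertexCoeff Bm e (labelRoot n) idx *
          ((∏ p ∈ pairs univ σ.1, Sym2.lift (propagator B hB e) (p.map idx)) *
                ħ ^ #(pairs univ σ.1)) := by
    intro σ
    have hamp : amplitude B hB Bm e (ofPairing (labelRoot n) σ) =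
        ∑ idx : HalfEdgeLabel n → Fin d, vertexCoeff Bm e (labelRoot n) idx *
          ∏ p ∈ pairs univ σ.1, Sym2.lift (propagator B hB e) (p.map idx) := by
      convert amplitude_ofPairing B Bm e hB (labelRoot n) σ
    rw [hamp, b_ofPairing, zpow_sub₀ hħ.ne', zpow_natCast, zpow_natCast]
    simp only [← mul_assoc]
    rw [← Finset.sum_mul, one_div, inv_pow]
    ring
  simp only [hσ]
  -- The prefactor `ħ^{-d/2}` cancels the `ħ^{d/2}` of the Gaussian normalization.
  rw [← Finset.mul_sum, Real.rpow_neg hħ.le]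
  have : ħ ^ ((d : ℝ) / 2) ≠ 0 := (Real.rpow_pos_of_pos hħ _).ne'
  field_simp

theorem eval₂_coeff_graphSeries (hB : B.IsSymm) {ħ : ℝ} (hħ : 0 < ħ) :
    LaurentPolynomial.eval₂ (RingHom.id ℝ) (Units.mk0 ħ hħ.ne')
        (MvPowerSeries.coeff n (graphSeries B hB Bm e)) =
      (2 * Real.pi) ^ ((d : ℝ) / 2) / Real.sqrt (gram B e).det *
        (((∏ i ∈ n.support, (n i)! * (i !) ^ n i : ℕ) : ℝ)⁻¹ *
          ∑ σ : {σ : Equiv.Perm (HalfEdgeLabel n) // σ ∈ pairings univ},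
            amplitude B hB Bm e (ofPairing (labelRoot n) σ) *
              ħ ^ (ofPairing (labelRoot n) σ).b) := by
  change LaurentPolynomial.eval₂ (RingHom.id ℝ) (Units.mk0 ħ hħ.ne')
    (LaurentPolynomial.C ((2 * Real.pi) ^ ((d : ℝ) / 2) / Real.sqrt (gram B e).det) *
      ∑ᶠ c ∈ FeynmanGraph.classes n, classTerm B hB Bm e c) = _
  have h := congrArg (LaurentPolynomial.eval₂ (RingHom.id ℝ) (Units.mk0 ħ hħ.ne'))
    (sum_pairings_eq_finsum_classes n (classTerm B hB Bm e))
  rw [map_sum, map_nsmul, nsmul_eq_mul] at h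
  have hK : ((∏ i ∈ n.support, (n i)! * (i !) ^ n i : ℕ) : ℝ) ≠ 0 := by
    rw [Nat.cast_ne_zero, Finset.prod_ne_zero_iff]
    intro i _
    positivity
  rw [map_mul, LaurentPolynomial.eval₂_C, RingHom.id_apply, (eq_inv_mul_iff_mul_eq₀ hK).2 h.symm]
  congr 2
  refine Finset.sum_congr rfl fun σ _ => ?_
  -- Orbit counting weights each pairing by `|Aut|`, which cancels the denominator in `graphTerm`.
  have hA : (Nat.card (ofPairing (labelRoot n) σ).Aut : ℝ) ≠ 0 := by
    have : Nonempty (ofPairing (labelRoot n) σ).Aut := ⟨Iso.refl _⟩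
    exact Nat.cast_ne_zero.2 Nat.card_pos.ne'
  change LaurentPolynomial.eval₂ _ _ (_ • graphTerm B hB Bm e (ofPairing (labelRoot n) σ)) = _
  rw [map_nsmul, nsmul_eq_mul, graphTerm, LaurentPolynomial.eval₂_C_mul_T, RingHom.id_apply,
    ← mul_assoc, mul_div_cancel₀ _ hA]
  simp

end Main

end Feynman

end

theorem mainTheorem4 {V : Type*} [AddCommGroup V] [Module ℝ V] {d : ℕ}
    (e : Module.Basis (Fin d) ℝ V)
    (B : LinearMap.BilinForm ℝ V) (hB : B.IsSymm) (hpos : ∀ x : V, x ≠ 0 → 0 < B x x)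
    (Bm : ∀ m : ℕ, MultilinearMap ℝ (fun _ : Fin m => V) ℝ) :
    (∀ n : ℕ →₀ ℕ, (FeynmanGraph.classes n).Finite) ∧
    (∀ ħ : ℝ, 0 < ħ → ∀ n : ℕ →₀ ℕ,
      MeasureTheory.Integrable fun t : Fin d → ℝ =>
        MvPowerSeries.coeff n (Feynman.integrand B Bm e ħ t)) ∧
    (∀ Z : MvPowerSeries ℕ (LaurentPolynomial ℝ),
      Feynman.IsPartitionSeries B Bm e Z ↔ Z = Feynman.graphSeries B hB Bm e) := by
  refine ⟨FeynmanGraph.finite_classes,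
    fun ħ hħ n => Feynman.integrable_coeff_integrand B Bm e n hB hpos hħ, fun Z => ?_⟩
  have key : Feynman.IsPartitionSeries B Bm e (Feynman.graphSeries B hB Bm e) := by
    intro ħ hħ
    ext n
    rw [MvPowerSeries.coeff_map, Feynman.eval₂_coeff_graphSeries B Bm e n hB hħ,
      Feynman.coeff_partitionFunction B Bm e n hB hpos hħ]
  refine ⟨fun hZ => ?_, fun hZ => hZ ▸ key⟩
  ext1 n
  refine Feynman.laurent_ext_of_eval₂ fun ħ hħ => ?_
  rw [← MvPowerSeries.coeff_map, ← MvPowerSeries.coeff_map, hZ ħ hħ, key ħ hħ]
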